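/- Let $n\in\mathbb N$. Let $\mathcal L_2^n$ be the space of signals $u:[0,\infty)\to\mathbb R^n$ (modulo equality almost everywhere) with $\|u\|_2^2=\int_0^\infty|u(t)|^2dt<\infty$. For $T\ge 0$ let $\Gamma_T u$ equal $u$ on $[0,T]$ and $0$ elsewhere, and let $\mathcal L_{2e}^n$ be the space of signals with $\Gamma_Tu\in\mathcal L_2^n$ for all $T>0$. An operator $P$ on $\mathcal L_{2e}^n$ is causal if $\Gamma_Tu_1=\Gamma_Tu_2$ implies $\Gamma_TPu_1=\Gamma_TPu_2$ for all $T>0$; $\mathcal N_n$ is the set of causal (possibly nonlinear) operators $P:\mathcal L_{2e}^n\to\mathcal L_{2e}^n$ with $P0=0$. $P$ is (finite-gain) stable if there is $\alpha>0$ with $\|\Gamma_TPu\|_2\le\alpha\|\Gamma_Tu\|_2$ for all $T\ge0$, $u\in\mathcal L_{2e}^n$; causality and stability of operators on $\mathcal L_{2e}^n\times\mathcal L_{2e}^n$ are defined in the same way. The Fourier transform of $u\in\mathcal L_2^n$ is the $L_2$-extension of $\hat u(j\omega)=\frac1{\sqrt{2\pi}}\int_0^\infty u(t)e^{-j\omega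 t}dt$, $\omega\in\mathbb R$. $P\in\mathcal N_n$ is negative imaginary (NI) if it is stable and there exist $\bar\Omega^*\ge\underline\Omega^*>0$ such that for all $\bar\Omega\ge\bar\Omega^*$ and $\underline\Omega\in(0,\underline\Omega^*]$, $$\mathrm{Re}\int_{\underline\Omega}^{\bar\Omega}\langle\hat u(j\omega),j\omega\,\widehat{Pu}(j\omega)\rangle\,d\omega\ge0\qquad\text{for all }u\in\mathcal L_2^n;$$ it is strictly negative imaginary (SNI) if it is stable and there exist $\bar\Omega^*\ge\underline\Omega^*>0$ such that for all $\bar\Omega\ge\bar\Omega^*$ and $\underline\Omega\in(0,\underline\Omega^*]$ there is $\epsilon=\epsilon(\bar\Omega,\underline\Omega)>0$ for which the left-hand side is at least $\epsilon\int_{\underline\Omega}^{\bar\Omega}|\hat u(j\omega)|^2d\omega$ for all $u\in\mathcal L_2^n$. The positive feedback system $P\,\#\,C$ is well-posed if the map $F_{P,C}:(u_1,y_2)\mapsto(d_1,d_2)=(u_1-Cy_2,\;y_2-Pu_1)$ on $\mathcal L_{2e}^n\times\mathcal L_{2e}^n$ has a causal inverse $F_{P,C}^{-1}$ defined on $\mathcal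 L_{2e}^n\times\mathcal L_{2e}^n$, and it is (finite-gain) stable if moreover $F_{P,C}^{-1}$ is finite-gain stable. **Proposition.** Let $P,C\in\mathcal N_n$, let $P$ be SNI and $C$ be NI, and let $P\,\#\,(\tau C)$ be well-posed for every $\tau\in[0,1]$. Suppose that there exist $\bar\Omega^*>\underline\Omega^*>0$, $\epsilon_0,\epsilon_\infty>0$, and measurable, essentially bounded, Hermitian-valued functions $\Pi_0,\Pi_\infty$ of $j\omega$, $\omega\in\mathbb R$, with values in $\mathbb C^{2n\times2n}$, such that for all $\underline\Omega\in(0,\underline\Omega^*]$, $\bar\Omega\in[\bar\Omega^*,\infty)$, $\tau\in[0,1]$ and $u,y\in\mathcal L_2^n$, $$\mathrm{Re}\int_0^{\underline\Omega}\begin{bmatrix}\widehat{Pu}\\\hat u\end{bmatrix}^*\Pi_0\begin{bmatrix}\widehat{Pu}\\\hat u\end{bmatrix}d\omega\le-\epsilon_0\int_0^{\underline\Omega}|\hat u|^2d\omega,\qquad \mathrm{Re}\int_0^{\underline\Omega}\begin{bmatrix}\hat y\\\widehat{\tau Cy}\end{bmatrix}^*\Pi_0\begin{bmatrix}\hat y\\\widehat{\tau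 Cy}\end{bmatrix}d\omega\ge0,$$ $$\mathrm{Re}\int_{\bar\Omega}^\infty\begin{bmatrix}\widehat{Pu}\\\hat u\end{bmatrix}^*\Pi_\infty\begin{bmatrix}\widehat{Pu}\\\hat u\end{bmatrix}d\omega\le-\epsilon_\infty\int_{\bar\Omega}^\infty|\hat u|^2d\omega,\qquad \mathrm{Re}\int_{\bar\Omega}^\infty\begin{bmatrix}\hat y\\\widehat{\tau Cy}\end{bmatrix}^*\Pi_\infty\begin{bmatrix}\hat y\\\widehat{\tau Cy}\end{bmatrix}d\omega\ge0.$$ Then $P\,\#\,C$ is finite-gain stable. -/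

import Mathlib

open MeasureTheory Complex
open scoped FourierTransform ENNReal Matrix

noncomputable section

namespace NegImag

/-- Lebesgue measure on the half-line of times `[0, ∞)`. -/
abbrev timeMeasure : Measure ℝ := volume.restrict (Set.Ici 0)

/-- Signals `[0, ∞) → E`: measurable functions modulo equality almost everywhere. -/
abbrev SignalIn (E : Type) [NormedAddCommGroup E] : Type := ℝ →ₘ[timeMeasure] E

/-- Signals `[0, ∞) → ℝⁿ`. -/
abbrev Signal (n : ℕ) : Type := SignalIn (EuclideanSpace ℝ (Fin n))

/-- The truncation `Γ_T u`: equal to `u` on `[0, T]`, and zero otherwise. -/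
def trunc {n : ℕ} (T : ℝ) (u : Signal n) : Signal n :=
  AEEqFun.mk ((Set.Icc 0 T).indicator u) (u.aestronglyMeasurable.indicator measurableSet_Icc)

theorem trunc_add {n : ℕ} (T : ℝ) (u v : Signal n) :
    trunc T (u + v) = trunc T u + trunc T v := by
  rw [trunc, trunc, trunc, AEEqFun.mk_add_mk, AEEqFun.mk_eq_mk]
  filter_upwards [AEEqFun.coeFn_add u v] with t ht
  by_cases h : t ∈ Set.Icc 0 T <;> simp [h, ht]

theorem trunc_smul {n : ℕ} (T : ℝ) (c : ℝ) (u : Signal n) :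
    trunc T (c • u) = c • trunc T u := by
  refine (AEEqFun.mk_eq_mk (hf := ?_) (hg := ?_)).2 ?_ |>.trans
    (AEEqFun.smul_mk c _ (u.aestronglyMeasurable.indicator measurableSet_Icc))
  · exact (u.aestronglyMeasurable.indicator measurableSet_Icc).const_smul c
  filter_upwards [AEEqFun.coeFn_smul c u] with t ht
  by_cases h : t ∈ Set.Icc 0 T <;> simp [h, ht]

/-- Energy-bounded signals: membership in `L₂ⁿ`. -/
def IsL2 {n : ℕ} (u : Signal n) : Prop := MemLp u 2 timeMeasure

/-- The norm `‖u‖₂` (meaningful for `u` in `L₂ⁿ`). -/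
def norm2 {n : ℕ} (u : Signal n) : ℝ := (eLpNorm u 2 timeMeasure).toReal

theorem IsL2.add {n : ℕ} {u v : Signal n} (hu : IsL2 u) (hv : IsL2 v) : IsL2 (u + v) :=
  (memLp_congr_ae (AEEqFun.coeFn_add u v)).2 (MemLp.add hu hv)

theorem IsL2.smul {n : ℕ} {u : Signal n} (c : ℝ) (hu : IsL2 u) : IsL2 (c • u) :=
  (memLp_congr_ae (AEEqFun.coeFn_smul c u)).2 (MemLp.const_smul hu c)

/-- The extended space `L₂ₑⁿ`: all truncations are energy-bounded. -/
def L2e (n : ℕ) : Submodule ℝ (Signal n) where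
  carrier := {u | ∀ T : ℝ, 0 < T → IsL2 (trunc T u)}
  add_mem' := by
    intro u v hu hv T hT
    rw [trunc_add]
    exact (hu T hT).add (hv T hT)
  zero_mem' := by
    intro T _
    have h : trunc T (0 : Signal n) = 0 := by
      have h0 := trunc_smul T 0 (0 : Signal n)
      rwa [zero_smul, zero_smul] at h0
    rw [h]
    exact (memLp_congr_ae AEEqFun.coeFn_zero).2 MemLp.zero
  smul_mem' := by
    intro c u hu T hT
    rw [trunc_smul]
    exact (hu T hT).smul c

/-- Causality of an operator on `L₂ₑⁿ`. -/
def Causal {n : ℕ} (P : L2e n → L2e n) : Prop :=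
  ∀ T : ℝ, 0 < T → ∀ u v : L2e n,
    trunc T (u : Signal n) = trunc T (v : Signal n) →
      trunc T (P u : Signal n) = trunc T (P v : Signal n)

/-- Membership in the class `𝒩ₙ`: causal operators that map `0` to `0`. -/
def IsSystem {n : ℕ} (P : L2e n → L2e n) : Prop := P 0 = 0 ∧ Causal P

/-- Finite-gain stability of an operator on `L₂ₑⁿ`. -/
def Stable {n : ℕ} (P : L2e n → L2e n) : Prop :=
  ∃ α : ℝ, 0 < α ∧ ∀ T : ℝ, 0 ≤ T → ∀ u : L2e n,
    norm2 (trunc T (P u : Signal n)) ≤ α * norm2 (trunc T (u : Signal n))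

/-! ### The feedback interconnection -/

/-- `‖Γ_T (a, b)‖₂` for a pair of signals. -/
def pairNorm2 {n : ℕ} (T : ℝ) (d : L2e n × L2e n) : ℝ :=
  Real.sqrt (norm2 (trunc T (d.1 : Signal n)) ^ 2 + norm2 (trunc T (d.2 : Signal n)) ^ 2)

/-- Causality of an operator on `L₂ₑⁿ × L₂ₑⁿ`. -/
def PairCausal {n : ℕ} (G : L2e n × L2e n → L2e n × L2e n) : Prop :=
  ∀ T : ℝ, 0 < T → ∀ d e : L2e n × L2e n,
    trunc T (d.1 : Signal n) = trunc T (e.1 : Signal n) →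
    trunc T (d.2 : Signal n) = trunc T (e.2 : Signal n) →
      trunc T ((G d).1 : Signal n) = trunc T ((G e).1 : Signal n) ∧
      trunc T ((G d).2 : Signal n) = trunc T ((G e).2 : Signal n)

/-- Finite-gain stability of an operator on `L₂ₑⁿ × L₂ₑⁿ`. -/
def PairStable {n : ℕ} (G : L2e n × L2e n → L2e n × L2e n) : Prop :=
  ∃ α : ℝ, 0 < α ∧ ∀ T : ℝ, 0 ≤ T → ∀ d : L2e n × L2e n,
    pairNorm2 T (G d) ≤ α * pairNorm2 T d

/-- The map `F_{P,C} : (u₁, y₂) ↦ (d₁, d₂) = (u₁ - C y₂, y₂ - P u₁)` of the positive feedback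
loop `P # C`. -/
def loopMap {n : ℕ} (P C : L2e n → L2e n) (x : L2e n × L2e n) : L2e n × L2e n :=
  (x.1 - C x.2, x.2 - P x.1)

/-- `G` is a causal two-sided inverse of `F_{P,C}` (unique if it exists). -/
def IsCausalLoopInverse {n : ℕ} (P C : L2e n → L2e n)
    (G : L2e n × L2e n → L2e n × L2e n) : Prop :=
  Function.LeftInverse G (loopMap P C) ∧ Function.RightInverse G (loopMap P C) ∧ PairCausal G

/-- `P # C` is well-posed: `F_{P,C}` is causally invertible. -/
def WellPosed {n : ℕ} (P C : L2e n → L2e n) : Prop :=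
  ∃ G, IsCausalLoopInverse P C G

/-- `P # C` is finite-gain stable: it is well-posed, and the inverse of `F_{P,C}` is
finite-gain stable. -/
def LoopStable {n : ℕ} (P C : L2e n → L2e n) : Prop :=
  ∃ G, IsCausalLoopInverse P C G ∧ PairStable G

/-! ### Fourier transforms and negative imaginariness -/

/-- A signal, extended by zero to negative times and viewed as `ℂⁿ`-valued. -/
def extendSignal {n : ℕ} (u : Signal n) : ℝ → EuclideanSpace ℂ (Fin n) :=
  (Set.Ici (0 : ℝ)).indicator fun t => WithLp.toLp 2 fun i => ((u t i : ℝ) : ℂ)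

theorem memLp_extendSignal {n : ℕ} {u : Signal n} (hu : IsL2 u) :
    MemLp (extendSignal u) 2 volume := by
  rw [extendSignal, memLp_indicator_iff_restrict measurableSet_Ici]
  have hc : Continuous fun x : EuclideanSpace ℝ (Fin n) =>
      (WithLp.toLp 2 fun i => ((x i : ℝ) : ℂ) : EuclideanSpace ℂ (Fin n)) := by
    fun_prop
  refine MemLp.of_le hu (hc.comp_aestronglyMeasurable u.aestronglyMeasurable)
    (Filter.Eventually.of_forall fun t => ?_)
  simp [EuclideanSpace.norm_eq]

open Classical in
/-- The Fourier transform of `u` in `L₂ⁿ` on the imaginary axis: `fourierSignal u ω` is `û(jω)`, the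
`L₂`-extension of `û(jω) = (2π)^(-1/2) ∫₀^∞ u(t) exp (-jωt) dt`. Mathlib's `𝓕` uses the kernel
`exp (-2πjξt)`, whence the rescaling. -/
def fourierSignal {n : ℕ} (u : Signal n) (ω : ℝ) : EuclideanSpace ℂ (Fin n) :=
  if hu : IsL2 u then
    (((Real.sqrt (2 * Real.pi))⁻¹ : ℝ) : ℂ) •
      (𝓕 ((memLp_extendSignal hu).toLp (extendSignal u)) :
        Lp (EuclideanSpace ℂ (Fin n)) 2 (volume : Measure ℝ)) (ω / (2 * Real.pi))
  else 0

/-- `Re ∫_{Ω₁}^{Ω₂} ⟨û(jω), jω ŷ(jω)⟩ dω` for `y = P u`. -/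
def niIntegral {n : ℕ} (P : L2e n → L2e n) (u : L2e n) (Ω₁ Ω₂ : ℝ) : ℝ :=
  (∫ ω in Set.Icc Ω₁ Ω₂,
    inner ℂ (fourierSignal (u : Signal n) ω)
      ((I * (ω : ℂ)) • fourierSignal (P u : Signal n) ω)).re

/-- Negative imaginary systems. -/
def IsNI {n : ℕ} (P : L2e n → L2e n) : Prop :=
  Stable P ∧ ∃ Ωl Ωh : ℝ, 0 < Ωl ∧ Ωl ≤ Ωh ∧
    ∀ Ω₁ Ω₂ : ℝ, 0 < Ω₁ → Ω₁ ≤ Ωl → Ωh ≤ Ω₂ →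
      ∀ u : L2e n, IsL2 (u : Signal n) → 0 ≤ niIntegral P u Ω₁ Ω₂

/-- Strictly negative imaginary systems. -/
def IsSNI {n : ℕ} (P : L2e n → L2e n) : Prop :=
  Stable P ∧ ∃ Ωl Ωh : ℝ, 0 < Ωl ∧ Ωl ≤ Ωh ∧
    ∀ Ω₁ Ω₂ : ℝ, 0 < Ω₁ → Ω₁ ≤ Ωl → Ωh ≤ Ω₂ →
      ∃ ε : ℝ, 0 < ε ∧ ∀ u : L2e n, IsL2 (u : Signal n) →
        ε * ∫ ω in Set.Icc Ω₁ Ω₂, ‖fourierSignal (u : Signal n) ω‖ ^ 2 ≤ niIntegral P u Ω₁ Ω₂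

/-! ### Integral quadratic forms -/

/-- A multiplier in `L_∞^{2n×2n}`, as a function of `ω` (its entries are measurable and essentially
bounded) that is Hermitian almost everywhere. -/
def IsHermitianMultiplier {n : ℕ}
    (M : ℝ → Matrix (Fin n ⊕ Fin n) (Fin n ⊕ Fin n) ℂ) : Prop :=
  (∀ i j, MemLp (fun ω => M ω i j) ∞ volume) ∧ ∀ᵐ ω : ℝ, (M ω).IsHermitian

/-- `Re ∫_S [â; b̂]^* M [â; b̂] dω`. -/
def iqc {n : ℕ} (M : ℝ → Matrix (Fin n ⊕ Fin n) (Fin n ⊕ Fin n) ℂ) (S : Set ℝ)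
    (a b : L2e n) : ℝ :=
  (∫ ω in S,
    star (Sum.elim (fourierSignal (a : Signal n) ω) (fourierSignal (b : Signal n) ω)) ⬝ᵥ
      (M ω *ᵥ
        Sum.elim (fourierSignal (a : Signal n) ω) (fourierSignal (b : Signal n) ω))).re

end NegImag

end

noncomputable section

namespace NegImag

/-! The proof combines an a priori estimate with a homotopy in `τ`.

Estimate (`exists_uniform_energy_bound`): for finite-energy `u`, `y`, the points `(P u, u)` and `(y,
τ C y)` differ exactly by the external inputs, up to sign. On each of three frequency bands there is
a bounded quadratic form that is at most `-c ∫ |û|²` at the first point and nonnegative at the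
second: the two multipliers of the hypothesis on the outer bands, and `jω [0 I; 0 0]` on the middle
one, where the conditions are SNI for `P` and NI for `C`. A bounded form changes between the two
points by at most `η` times the energy of the first plus a multiple of the input energy
(`exists_iqc_add_le`). Summing over the bands, using Plancherel and the finite gain of `P`, and
taking `η` small bounds `u`, hence `y`, by the inputs, with a constant `γ` independent of `τ`. The
bands cover only `ω ≥ 0`; since signals are real, this half-line carries half of the energy.

Homotopy (`loopStable_of_uniform_energy_bound`): the estimate presupposes finite energy. If the loop
at `τ` has any finite gain, truncated inputs produce finite-energy solutions, and causality turns
the estimate into gain `γ` (`HasEnergyGain.improve`). Gain `γ` at `τ` gives gain `4γ` for all `σ`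
within a distance depending only on `γ` and `C` (`HasEnergyGain.perturb`), which improves to `γ`
again. Finitely many equal steps lead from the open loop `τ = 0` to `τ = 1`. -/

/-! ### Complex conjugation and the Fourier transform. -/

/-- Entrywise complex conjugation on `ℂⁿ`, as a real-linear map. -/
def conjMap (n : ℕ) : EuclideanSpace ℂ (Fin n) →L[ℝ] EuclideanSpace ℂ (Fin n) :=
  LinearMap.toContinuousLinearMap
    { toFun := fun v => WithLp.toLp 2 fun i => star (v i)
      map_add' := fun v w => by ext i; simp
      map_smul' := fun c v => by ext i; simp }

theorem conjMap_apply {n : ℕ} (v : EuclideanSpace ℂ (Fin n)) (i : Fin n) :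
    conjMap n v i = star (v i) := rfl

theorem norm_conjMap {n : ℕ} (v : EuclideanSpace ℂ (Fin n)) : ‖conjMap n v‖ = ‖v‖ := by
  simp [EuclideanSpace.norm_eq, conjMap_apply]

theorem conjMap_smul {n : ℕ} (c : ℂ) (v : EuclideanSpace ℂ (Fin n)) :
    conjMap n (c • v) = star c • conjMap n v := by
  ext i; simp [conjMap_apply]

theorem conjMap_fourier_schwartz {n : ℕ} (f : SchwartzMap ℝ (EuclideanSpace ℂ (Fin n))) (x : ℝ) :
    conjMap n (𝓕 f x) = 𝓕 (SchwartzMap.postcompCLM (conjMap n) f) (-x) := by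
  rw [SchwartzMap.fourier_coe, SchwartzMap.fourier_coe, Real.fourier_eq, Real.fourier_eq,
    ← ContinuousLinearMap.integral_comp_comm]
  · refine integral_congr_ae (Filter.Eventually.of_forall fun v => ?_)
    simp only [Circle.smul_def, conjMap_smul, SchwartzMap.postcompCLM_apply,
      inner_neg_right, neg_neg]
    congr 1
    rw [Complex.star_def, ← Circle.coe_inv_eq_conj, ← AddChar.map_neg_eq_inv, neg_neg]
  · exact (Real.fourierIntegral_convergent_iff x).2 f.integrable

/-- Both sides are continuous in `f`, and on the dense set of Schwartz functions the identity can be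
read off the integral. -/
theorem conjMap_fourier_Lp {n : ℕ}
    (f : Lp (EuclideanSpace ℂ (Fin n)) 2 (volume : Measure ℝ)) :
    (conjMap n).compLp (𝓕 f) =
      Lp.compMeasurePreserving (fun x : ℝ => -x) (Measure.measurePreserving_neg volume)
        (𝓕 ((conjMap n).compLp f)) := by
  refine DenseRange.induction_on
    (p := fun f : Lp (EuclideanSpace ℂ (Fin n)) 2 (volume : Measure ℝ) =>
      (conjMap n).compLp (𝓕 f) =
      Lp.compMeasurePreserving (fun x : ℝ => -x) (Measure.measurePreserving_neg volume)
        (𝓕 ((conjMap n).compLp f)))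
    (SchwartzMap.denseRange_toLpCLM (p := 2) ENNReal.ofNat_ne_top) f ?_ ?_
  · have hc : Continuous fun f : Lp (EuclideanSpace ℂ (Fin n)) 2 (volume : Measure ℝ) =>
        (conjMap n).compLp f := ((conjMap n).compLpL 2 volume).continuous
    have hF : Continuous fun f : Lp (EuclideanSpace ℂ (Fin n)) 2 (volume : Measure ℝ) => 𝓕 f :=
      (Lp.fourierTransformₗᵢ ℝ (EuclideanSpace ℂ (Fin n))).continuous
    exact isClosed_eq (hc.comp hF)
      ((Lp.isometry_compMeasurePreserving _).continuous.comp (hF.comp hc))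
  · intro g
    have hg : (conjMap n).compLp (g.toLp 2 volume) =
        (SchwartzMap.postcompCLM (conjMap n) g).toLp 2 volume := by
      refine Lp.ext ?_
      filter_upwards [(conjMap n).coeFn_compLp (g.toLp 2 volume), g.coeFn_toLp 2 volume,
        (SchwartzMap.postcompCLM (conjMap n) g).coeFn_toLp 2 volume] with x h1 h2 h3
      rw [h1, h2, h3]; rfl
    rw [SchwartzMap.toLpCLM_apply, hg, SchwartzMap.toLp_fourier_eq, SchwartzMap.toLp_fourier_eq]
    refine Lp.ext ?_
    filter_upwards [(conjMap n).coeFn_compLp ((𝓕 g).toLp 2 volume), (𝓕 g).coeFn_toLp 2 volume,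
      Lp.coeFn_compMeasurePreserving
        ((𝓕 (SchwartzMap.postcompCLM (conjMap n) g)).toLp 2 volume)
        (Measure.measurePreserving_neg (volume : Measure ℝ)),
      (Measure.measurePreserving_neg (volume : Measure ℝ)).quasiMeasurePreserving.ae_eq_comp
        ((𝓕 (SchwartzMap.postcompCLM (conjMap n) g)).coeFn_toLp 2 volume)] with x h1 h2 h3 h4
    rw [h1, h2, h3, h4]
    exact conjMap_fourier_schwartz g x

/-! ### Energy, Plancherel and the symmetry of the spectrum. -/

/-- The squared norm `‖u‖₂²`. -/
def energy {n : ℕ} (u : Signal n) : ℝ := norm2 u ^ 2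

theorem energy_nonneg {n : ℕ} (u : Signal n) : 0 ≤ energy u := sq_nonneg _

theorem norm_extendSignal {n : ℕ} (u : Signal n) (t : ℝ) :
    ‖extendSignal u t‖ = (Set.Ici (0 : ℝ)).indicator (fun t => ‖u t‖) t := by
  by_cases h : t ∈ Set.Ici (0 : ℝ)
  · simp [extendSignal, h, EuclideanSpace.norm_eq]
  · simp [extendSignal, h]

theorem norm_toLp_extendSignal {n : ℕ} {u : Signal n} (hu : IsL2 u) :
    ‖(memLp_extendSignal hu).toLp (extendSignal u)‖ = norm2 u := by
  rw [Lp.norm_toLp, norm2, ← eLpNorm_indicator_eq_eLpNorm_restrict measurableSet_Ici]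
  congr 1
  refine eLpNorm_congr_norm_ae (Filter.Eventually.of_forall fun t => ?_)
  rw [norm_extendSignal, norm_indicator_eq_indicator_norm]

theorem fourierSignal_of_isL2 {n : ℕ} {u : Signal n} (hu : IsL2 u) (ω : ℝ) :
    fourierSignal u ω = (((Real.sqrt (2 * Real.pi))⁻¹ : ℝ) : ℂ) •
      (𝓕 ((memLp_extendSignal hu).toLp (extendSignal u)) :
        Lp (EuclideanSpace ℂ (Fin n)) 2 (volume : Measure ℝ)) (ω / (2 * Real.pi)) := by
  rw [fourierSignal, dif_pos hu]

/-- Transfers almost-everywhere identities for `𝓕` to the rescaled frequency variable of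
`fourierSignal`. -/
theorem quasiMeasurePreserving_div_two_pi :
    Measure.QuasiMeasurePreserving (fun ω : ℝ => ω / (2 * Real.pi)) volume volume := by
  refine ⟨by fun_prop, ?_⟩
  have h := Real.map_volume_mul_right (a := (2 * Real.pi)⁻¹) (by positivity)
  simp only [div_eq_mul_inv]
  rw [h]
  exact Measure.smul_absolutelyContinuous

theorem integral_norm_sq_Lp {E : Type*} [NormedAddCommGroup E]
    (f : Lp E 2 (volume : Measure ℝ)) : ∫ x, ‖f x‖ ^ 2 = ‖f‖ ^ 2 := by
  rw [Lp.norm_def, (Lp.memLp f).eLpNorm_eq_integral_rpow_norm two_ne_zero ENNReal.ofNat_ne_top]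
  have h : 0 ≤ ∫ x, ‖f x‖ ^ 2 := integral_nonneg fun x => sq_nonneg _
  simp only [ENNReal.toReal_ofNat, Real.rpow_ofNat]
  rw [ENNReal.toReal_ofReal (by positivity), ← Real.rpow_natCast, ← Real.rpow_mul h]
  norm_num

/-- Plancherel: the squared prefactor `1 / (2π)` cancels the Jacobian of the frequency rescaling. -/
theorem integral_norm_sq_fourierSignal {n : ℕ} {u : Signal n} (hu : IsL2 u) :
    ∫ ω, ‖fourierSignal u ω‖ ^ 2 = energy u := by
  set f := (memLp_extendSignal hu).toLp (extendSignal u) with hf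
  have h1 : ∀ ω, ‖fourierSignal u ω‖ ^ 2 =
      (2 * Real.pi)⁻¹ * ‖(𝓕 f : Lp _ 2 _) (ω / (2 * Real.pi))‖ ^ 2 := by
    intro ω
    rw [fourierSignal_of_isL2 hu, norm_smul, mul_pow]
    congr 1
    rw [Complex.norm_real, Real.norm_of_nonneg (by positivity), inv_pow,
      Real.sq_sqrt (by positivity)]
  simp_rw [h1]
  rw [integral_const_mul,
    Measure.integral_comp_div (fun x => ‖(𝓕 f : Lp _ 2 (volume : Measure ℝ)) x‖ ^ 2),
    integral_norm_sq_Lp, Lp.norm_fourier_eq, hf, norm_toLp_extendSignal hu, smul_eq_mul,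
    abs_of_pos (by positivity), ← mul_assoc, inv_mul_cancel₀ (by positivity), one_mul, energy]

theorem memLp_fourierSignal {n : ℕ} {u : Signal n} (hu : IsL2 u) :
    MemLp (fourierSignal u) 2 volume := by
  set f := (memLp_extendSignal hu).toLp (extendSignal u) with hf
  have h : fourierSignal u = fun ω => (((Real.sqrt (2 * Real.pi))⁻¹ : ℝ) : ℂ) •
      (𝓕 f : Lp (EuclideanSpace ℂ (Fin n)) 2 (volume : Measure ℝ)) (ω / (2 * Real.pi)) := by
    ext1 ω; rw [fourierSignal_of_isL2 hu]
  rw [h]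
  suffices hs : MemLp (fun ω : ℝ => (𝓕 f : Lp (EuclideanSpace ℂ (Fin n)) 2 (volume : Measure ℝ))
      (ω / (2 * Real.pi))) 2 volume from hs.const_smul (((Real.sqrt (2 * Real.pi))⁻¹ : ℝ) : ℂ)
  have h2 := (Lp.memLp (𝓕 f))
  have hm := (Lp.aestronglyMeasurable (𝓕 f)).comp_quasiMeasurePreserving
    quasiMeasurePreserving_div_two_pi
  refine (memLp_two_iff_integrable_sq_norm hm).2 ?_
  exact ((memLp_two_iff_integrable_sq_norm h2.1).1 h2).comp_div (by positivity)

theorem IsL2.sub {n : ℕ} {u v : Signal n} (hu : IsL2 u) (hv : IsL2 v) : IsL2 (u - v) := by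
  have := hu.add (hv.smul (-1)); rwa [neg_one_smul, ← sub_eq_add_neg] at this

theorem fourierSignal_add {n : ℕ} {u v : Signal n} (hu : IsL2 u) (hv : IsL2 v) :
    fourierSignal (u + v) =ᵐ[volume] fun ω => fourierSignal u ω + fourierSignal v ω := by
  have h : (memLp_extendSignal (hu.add hv)).toLp (extendSignal (u + v)) =
      (memLp_extendSignal hu).toLp (extendSignal u) +
        (memLp_extendSignal hv).toLp (extendSignal v) := by
    rw [← MemLp.toLp_add, MemLp.toLp_eq_toLp_iff]
    have := (ae_restrict_iff' measurableSet_Ici).1 (AEEqFun.coeFn_add u v)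
    filter_upwards [this] with t ht
    by_cases h0 : t ∈ Set.Ici (0 : ℝ)
    · ext i
      simp [extendSignal, h0, ht h0]
    · simp [extendSignal, h0]
  have h2 : (𝓕 ((memLp_extendSignal hu).toLp (extendSignal u) +
        (memLp_extendSignal hv).toLp (extendSignal v)) : Lp _ 2 (volume : Measure ℝ)) =
      𝓕 ((memLp_extendSignal hu).toLp (extendSignal u)) +
        𝓕 ((memLp_extendSignal hv).toLp (extendSignal v)) := FourierTransform.fourier_add _ _
  filter_upwards [quasiMeasurePreserving_div_two_pi.ae_eq_comp (Lp.coeFn_add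
    (𝓕 ((memLp_extendSignal hu).toLp (extendSignal u)))
        (𝓕 ((memLp_extendSignal hv).toLp (extendSignal v))))] with ω hω
  rw [fourierSignal_of_isL2 hu, fourierSignal_of_isL2 hv, fourierSignal_of_isL2 (hu.add hv), h, h2,
    ← smul_add]
  congr 1

theorem fourierSignal_smul {n : ℕ} {u : Signal n} (c : ℝ) (hu : IsL2 u) :
    fourierSignal (c • u) =ᵐ[volume] fun ω => (c : ℂ) • fourierSignal u ω := by
  have h : (memLp_extendSignal (hu.smul c)).toLp (extendSignal (c • u)) =
      (c : ℂ) • (memLp_extendSignal hu).toLp (extendSignal u) := by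
    rw [← MemLp.toLp_const_smul, MemLp.toLp_eq_toLp_iff]
    have := (ae_restrict_iff' measurableSet_Ici).1 (AEEqFun.coeFn_smul c u)
    filter_upwards [this] with t ht
    by_cases h0 : t ∈ Set.Ici (0 : ℝ)
    · ext i
      simp [extendSignal, h0, ht h0]
    · simp [extendSignal, h0]
  have h2 : (𝓕 ((c : ℂ) • (memLp_extendSignal hu).toLp (extendSignal u)) :
      Lp _ 2 (volume : Measure ℝ)) = (c : ℂ) • 𝓕 ((memLp_extendSignal hu).toLp (extendSignal u)) :=
    FourierTransform.fourier_smul _ _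
  filter_upwards [quasiMeasurePreserving_div_two_pi.ae_eq_comp (Lp.coeFn_smul (c : ℂ)
    (𝓕 ((memLp_extendSignal hu).toLp (extendSignal u))))] with ω hω
  rw [fourierSignal_of_isL2 hu, fourierSignal_of_isL2 (hu.smul c), h, h2, smul_comm]
  congr 1

theorem norm_fourierSignal_neg {n : ℕ} {u : Signal n} (hu : IsL2 u) :
    ∀ᵐ ω : ℝ, ‖fourierSignal u (-ω)‖ = ‖fourierSignal u ω‖ := by
  set f := (memLp_extendSignal hu).toLp (extendSignal u) with hf
  -- A real signal is fixed by conjugation, so conjugating its transform only reflects the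
  -- frequency.
  have hfix : (conjMap n).compLp f = f := by
    refine Lp.ext ?_
    filter_upwards [(conjMap n).coeFn_compLp f, (memLp_extendSignal hu).coeFn_toLp] with t h1 h2
    rw [h1, h2]
    by_cases h0 : t ∈ Set.Ici (0 : ℝ)
    · ext i
      simp [extendSignal, h0, conjMap_apply]
    · simp [extendSignal, h0]
  have h := conjMap_fourier_Lp f
  rw [hfix] at h
  have h3 : ∀ᵐ x : ℝ, ‖(𝓕 f : Lp _ 2 (volume : Measure ℝ)) (-x)‖ =
      ‖(𝓕 f : Lp _ 2 (volume : Measure ℝ)) x‖ := by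
    filter_upwards [(conjMap n).coeFn_compLp (𝓕 f), Lp.coeFn_compMeasurePreserving (𝓕 f)
      (Measure.measurePreserving_neg (volume : Measure ℝ))] with x h1 h2
    rw [← norm_conjMap ((𝓕 f : Lp _ 2 (volume : Measure ℝ)) x), ← h1, h, h2]
    rfl
  filter_upwards [quasiMeasurePreserving_div_two_pi.ae h3] with ω hω
  rw [fourierSignal_of_isL2 hu, fourierSignal_of_isL2 hu, norm_smul, norm_smul, neg_div, hω]

theorem integrable_norm_sq_fourierSignal {n : ℕ} {u : Signal n} (hu : IsL2 u) :
    Integrable fun ω => ‖fourierSignal u ω‖ ^ 2 :=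
  (memLp_two_iff_integrable_sq_norm (memLp_fourierSignal hu).1).1 (memLp_fourierSignal hu)

/-- The spectrum of a real signal has even modulus, so each half-line contributes equally. -/
theorem setIntegral_Ici_norm_sq_fourierSignal {n : ℕ} {u : Signal n} (hu : IsL2 u) :
    ∫ ω in Set.Ici (0 : ℝ), ‖fourierSignal u ω‖ ^ 2 = energy u / 2 := by
  have hi := integrable_norm_sq_fourierSignal hu
  have h1 := intervalIntegral.integral_Iic_add_Ioi (b := (0 : ℝ)) hi.integrableOn hi.integrableOn
  have h2 := integral_comp_neg_Ioi (0 : ℝ) fun ω => ‖fourierSignal u ω‖ ^ 2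
  rw [neg_zero] at h2
  have h3 : ∫ ω in Set.Ioi (0 : ℝ), ‖fourierSignal u (-ω)‖ ^ 2 =
      ∫ ω in Set.Ioi (0 : ℝ), ‖fourierSignal u ω‖ ^ 2 := by
    refine integral_congr_ae (ae_restrict_of_ae ?_)
    filter_upwards [norm_fourierSignal_neg hu] with ω hω
    rw [hω]
  rw [integral_norm_sq_fourierSignal hu] at h1
  rw [integral_Ici_eq_integral_Ioi]
  linarith

/-! ### Quadratic forms with bounded multipliers. -/

theorem norm_star_dotProduct_mulVec_le {ι : Type*} [Fintype ι] {A : Matrix ι ι ℂ} {K : ℝ}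
    (hA : ∀ i j, ‖A i j‖ ≤ K) (v w : ι → ℂ) :
    ‖star v ⬝ᵥ (A *ᵥ w)‖ ≤ K * ((∑ i, ‖v i‖) * ∑ j, ‖w j‖) := by
  calc ‖star v ⬝ᵥ (A *ᵥ w)‖ ≤ ∑ i, ‖v i‖ * ∑ j, K * ‖w j‖ := by
        refine (norm_sum_le _ _).trans (Finset.sum_le_sum fun i _ => ?_)
        rw [norm_mul, Pi.star_apply, norm_star]
        refine mul_le_mul_of_nonneg_left ?_ (norm_nonneg _)
        refine (norm_sum_le _ _).trans (Finset.sum_le_sum fun j _ => ?_)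
        rw [norm_mul]
        exact mul_le_mul_of_nonneg_right (hA i j) (norm_nonneg _)
    _ = K * ((∑ i, ‖v i‖) * ∑ j, ‖w j‖) := by
        rw [← Finset.mul_sum, ← Finset.sum_mul]; ring

/-- The cross terms are split by Young's inequality with weight `η`; the cardinality comes from
Cauchy–Schwarz, passing from `ℓ¹` to `ℓ²` norms. -/
theorem norm_quadForm_add_sub_le {ι : Type*} [Fintype ι] {A : Matrix ι ι ℂ} {K η : ℝ}
    (hK : 0 ≤ K) (hη : 0 < η) (hA : ∀ i j, ‖A i j‖ ≤ K) (v e : ι → ℂ) :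
    ‖star (v + e) ⬝ᵥ (A *ᵥ (v + e)) - star v ⬝ᵥ (A *ᵥ v)‖ ≤
      K * Fintype.card ι * (η * ∑ i, ‖v i‖ ^ 2 + (1 + 1 / η) * ∑ i, ‖e i‖ ^ 2) := by
  have hsplit : star (v + e) ⬝ᵥ (A *ᵥ (v + e)) - star v ⬝ᵥ (A *ᵥ v) =
      star v ⬝ᵥ (A *ᵥ e) + star e ⬝ᵥ (A *ᵥ v) + star e ⬝ᵥ (A *ᵥ e) := by
    rw [star_add, Matrix.mulVec_add, add_dotProduct, dotProduct_add, dotProduct_add]; ring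
  set a := ∑ i, ‖v i‖
  set b := ∑ i, ‖e i‖
  have ha2 : a ^ 2 ≤ Fintype.card ι * ∑ i, ‖v i‖ ^ 2 :=
    sq_sum_le_card_mul_sum_sq
  have hb2 : b ^ 2 ≤ Fintype.card ι * ∑ i, ‖e i‖ ^ 2 :=
    sq_sum_le_card_mul_sum_sq
  have hyoung : 2 * (a * b) ≤ η * a ^ 2 + 1 / η * b ^ 2 := by
    have h := mul_nonneg (one_div_pos.2 hη).le (sq_nonneg (η * a - b))
    have h' : 1 / η * (η * a - b) ^ 2 = η * a ^ 2 + 1 / η * b ^ 2 - 2 * (a * b) := by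
      field_simp
      ring
    linarith
  rw [hsplit]
  have h1 := norm_star_dotProduct_mulVec_le hA v e
  have h2 := norm_star_dotProduct_mulVec_le hA e v
  have h3 := norm_star_dotProduct_mulVec_le hA e e
  have hη' : 0 ≤ 1 + 1 / η := by positivity
  calc _ ≤ K * (a * b) + K * (b * a) + K * (b * b) := (norm_add₃_le).trans (by gcongr)
    _ = K * (2 * (a * b) + b ^ 2) := by ring
    _ ≤ K * (η * a ^ 2 + (1 + 1 / η) * b ^ 2) := by
        refine mul_le_mul_of_nonneg_left ?_ hK; linarith
    _ ≤ K * (η * (Fintype.card ι * ∑ i, ‖v i‖ ^ 2) +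
          (1 + 1 / η) * (Fintype.card ι * ∑ i, ‖e i‖ ^ 2)) := by gcongr
    _ = _ := by ring

/-- The entries of `M` are measurable and essentially bounded. -/
def IsBoundedMultiplier {n : ℕ}
    (M : ℝ → Matrix (Fin n ⊕ Fin n) (Fin n ⊕ Fin n) ℂ) : Prop :=
  ∀ i j, MemLp (fun ω => M ω i j) ∞ volume

theorem IsBoundedMultiplier.exists_bound {n : ℕ}
    {M : ℝ → Matrix (Fin n ⊕ Fin n) (Fin n ⊕ Fin n) ℂ} (hM : IsBoundedMultiplier M) :
    ∃ K : ℝ, 0 ≤ K ∧ ∀ᵐ ω : ℝ, ∀ i j, ‖M ω i j‖ ≤ K := by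
  let k : Fin n ⊕ Fin n → Fin n ⊕ Fin n → ℝ := fun i j =>
    (eLpNorm (fun ω => M ω i j) ∞ volume).toReal
  have hk : ∀ i j, 0 ≤ k i j := fun i j => ENNReal.toReal_nonneg
  refine ⟨∑ i, ∑ j, k i j, Finset.sum_nonneg fun i _ => Finset.sum_nonneg fun j _ => hk i j, ?_⟩
  rw [ae_all_iff]; intro i
  rw [ae_all_iff]; intro j
  have h := ae_le_eLpNormEssSup (f := fun ω => M ω i j) (μ := (volume : Measure ℝ))
  filter_upwards [h] with ω hω
  rw [← eLpNorm_exponent_top] at hω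
  have h2 : ‖M ω i j‖ ≤ k i j := by
    have := ENNReal.toReal_mono (hM i j).eLpNorm_ne_top hω
    simpa [k] using this
  calc ‖M ω i j‖ ≤ k i j := h2
    _ ≤ ∑ j, k i j := Finset.single_le_sum (fun j _ => hk i j) (Finset.mem_univ j)
    _ ≤ ∑ i, ∑ j, k i j := Finset.single_le_sum (f := fun i => ∑ j, k i j)
        (fun i _ => Finset.sum_nonneg fun j _ => hk i j) (Finset.mem_univ i)

theorem memLp_elim_fourierSignal {n : ℕ} {a b : Signal n} (ha : IsL2 a) (hb : IsL2 b)
    (i : Fin n ⊕ Fin n) :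
    MemLp (fun ω => Sum.elim (fourierSignal a ω) (fourierSignal b ω) i) 2 volume := by
  have hcoord : ∀ {u : Signal n}, IsL2 u → ∀ i, MemLp (fun ω => fourierSignal u ω i) 2 volume := by
    intro u hu i
    exact (EuclideanSpace.proj (𝕜 := ℂ) i).comp_memLp' (memLp_fourierSignal hu)
  cases i with
  | inl i => exact hcoord ha i
  | inr i => exact hcoord hb i

theorem integrable_quadForm {n : ℕ} {M : ℝ → Matrix (Fin n ⊕ Fin n) (Fin n ⊕ Fin n) ℂ}
    (hM : IsBoundedMultiplier M) {a b : Signal n} (ha : IsL2 a) (hb : IsL2 b) :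
    Integrable fun ω => star (Sum.elim (fourierSignal a ω) (fourierSignal b ω)) ⬝ᵥ
      (M ω *ᵥ Sum.elim (fourierSignal a ω) (fourierSignal b ω)) := by
  have hv := memLp_elim_fourierSignal ha hb
  simp only [dotProduct, Matrix.mulVec, Pi.star_apply]
  refine integrable_finsetSum _ fun i _ => ?_
  refine MemLp.integrable_mul (p := 2) (q := 2) (hv i).star ?_
  exact memLp_finsetSum _ fun j _ => (hv j).mul (p := ∞) (q := 2) (hM i j)

theorem sum_norm_sq_elim {n : ℕ} (v w : EuclideanSpace ℂ (Fin n)) :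
    ∑ i, ‖(Sum.elim v w : Fin n ⊕ Fin n → ℂ) i‖ ^ 2 = ‖v‖ ^ 2 + ‖w‖ ^ 2 := by
  simp [EuclideanSpace.norm_sq_eq]

/-- A quadratic form with bounded multiplier changes, under a perturbation of its arguments, by at
most a small multiple of the energy of the arguments and a multiple of that of the perturbation. -/
theorem exists_iqc_add_le {n : ℕ} {M : ℝ → Matrix (Fin n ⊕ Fin n) (Fin n ⊕ Fin n) ℂ}
    (hM : IsBoundedMultiplier M) (S : Set ℝ) :
    ∃ K : ℝ, 0 ≤ K ∧ ∀ η : ℝ, 0 < η → ∀ a b p q : L2e n, IsL2 (a : Signal n) →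
      IsL2 (b : Signal n) → IsL2 (p : Signal n) → IsL2 (q : Signal n) →
      iqc M S (a + p) (b + q) ≤ iqc M S a b +
        K * (η * (energy (a : Signal n) + energy (b : Signal n)) +
          (1 + 1 / η) * (energy (p : Signal n) + energy (q : Signal n))) := by
  obtain ⟨K, hK, hMK⟩ := hM.exists_bound
  refine ⟨K * Fintype.card (Fin n ⊕ Fin n), by positivity, ?_⟩
  intro η hη a b p q ha hb hp hq
  have hi1 := (integrable_quadForm hM (ha.add hp) (hb.add hq)).integrableOn (s := S)
  have hi2 := (integrable_quadForm hM ha hb).integrableOn (s := S)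
  have hb0 : Integrable fun ω => K * Fintype.card (Fin n ⊕ Fin n) *
      (η * (‖fourierSignal (a : Signal n) ω‖ ^ 2 + ‖fourierSignal (b : Signal n) ω‖ ^ 2) +
        (1 + 1 / η) *
          (‖fourierSignal (p : Signal n) ω‖ ^ 2 + ‖fourierSignal (q : Signal n) ω‖ ^ 2)) :=
    ((((integrable_norm_sq_fourierSignal ha).add
      (integrable_norm_sq_fourierSignal hb)).const_mul _).add
      (((integrable_norm_sq_fourierSignal hp).add
      (integrable_norm_sq_fourierSignal hq)).const_mul _)).const_mul _
  rw [← sub_le_iff_le_add']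
  rw [iqc, iqc, ← Complex.sub_re, ← integral_sub (by exact hi1) hi2]
  refine (Complex.re_le_norm _).trans ?_
  refine (norm_integral_le_integral_norm _).trans ?_
  have hb1 : ∫ ω, K * Fintype.card (Fin n ⊕ Fin n) *
      (η * (‖fourierSignal (a : Signal n) ω‖ ^ 2 + ‖fourierSignal (b : Signal n) ω‖ ^ 2) +
        (1 + 1 / η) *
          (‖fourierSignal (p : Signal n) ω‖ ^ 2 + ‖fourierSignal (q : Signal n) ω‖ ^ 2)) =
      K * Fintype.card (Fin n ⊕ Fin n) * (η * (energy (a : Signal n) + energy (b : Signal n)) +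
          (1 + 1 / η) * (energy (p : Signal n) + energy (q : Signal n))) := by
    have ia := integrable_norm_sq_fourierSignal ha
    have ib := integrable_norm_sq_fourierSignal hb
    have ip := integrable_norm_sq_fourierSignal hp
    have iq := integrable_norm_sq_fourierSignal hq
    have iab : Integrable fun ω =>
        ‖fourierSignal (a : Signal n) ω‖ ^ 2 + ‖fourierSignal (b : Signal n) ω‖ ^ 2 := ia.add ib
    have ipq : Integrable fun ω =>
        ‖fourierSignal (p : Signal n) ω‖ ^ 2 + ‖fourierSignal (q : Signal n) ω‖ ^ 2 := ip.add iq
    rw [integral_const_mul, integral_add (iab.const_mul _) (ipq.const_mul _),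
      integral_const_mul, integral_const_mul, integral_add ia ib, integral_add ip iq,
      integral_norm_sq_fourierSignal ha, integral_norm_sq_fourierSignal hb,
      integral_norm_sq_fourierSignal hp, integral_norm_sq_fourierSignal hq]
  rw [← hb1]
  -- The dominating function is nonnegative, so `S` may be enlarged to all of `ℝ`, where Plancherel
  -- evaluates the integral.
  refine le_trans ?_ (setIntegral_le_integral (s := S) hb0
    (Filter.Eventually.of_forall fun ω => by simp only [Pi.zero_apply]; positivity))
  refine integral_mono_ae (hi1.sub hi2).norm hb0.integrableOn (ae_restrict_of_ae ?_)
  filter_upwards [hMK, fourierSignal_add ha hp, fourierSignal_add hb hq] with ω h1 h2 h3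
  have h4 := norm_quadForm_add_sub_le hK hη h1
    (Sum.elim (fourierSignal (a : Signal n) ω) (fourierSignal (b : Signal n) ω))
    (Sum.elim (fourierSignal (p : Signal n) ω) (fourierSignal (q : Signal n) ω))
  rw [sum_norm_sq_elim, sum_norm_sq_elim] at h4
  have h5 : (Sum.elim (fourierSignal ((a + p : L2e n) : Signal n) ω)
      (fourierSignal ((b + q : L2e n) : Signal n) ω) : Fin n ⊕ Fin n → ℂ) =
      Sum.elim (fourierSignal (a : Signal n) ω) (fourierSignal (b : Signal n) ω) +
      Sum.elim (fourierSignal (p : Signal n) ω) (fourierSignal (q : Signal n) ω) := by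
    rw [Submodule.coe_add, Submodule.coe_add, h2, h3]
    funext i
    cases i <;> simp
  rw [h5]
  exact h4

/-! ### The negative imaginary condition as a quadratic form. -/

/-- The multiplier `jω [0 I; 0 0]` on the band `[Ω₁, Ω₂]`. -/
def niMultiplier (n : ℕ) (Ω₁ Ω₂ : ℝ) (ω : ℝ) : Matrix (Fin n ⊕ Fin n) (Fin n ⊕ Fin n) ℂ :=
  (Set.Icc Ω₁ Ω₂).indicator (fun ω : ℝ => I * (ω : ℂ)) ω • Matrix.fromBlocks 0 1 0 0

theorem isBoundedMultiplier_niMultiplier (n : ℕ) (Ω₁ Ω₂ : ℝ) :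
    IsBoundedMultiplier (niMultiplier n Ω₁ Ω₂) := by
  intro i j
  have h : MemLp ((Set.Icc Ω₁ Ω₂).indicator fun ω : ℝ => I * (ω : ℂ)) ∞ volume := by
    refine memLp_top_of_bound (C := max |Ω₁| |Ω₂|)
      ((Continuous.aestronglyMeasurable (by fun_prop)).indicator measurableSet_Icc)
      (Filter.Eventually.of_forall fun ω => ?_)
    by_cases hω : ω ∈ Set.Icc Ω₁ Ω₂
    · simpa [hω] using abs_le_max_abs_abs hω.1 hω.2
    · simp [hω]
  exact h.mul_const _

theorem star_dotProduct_niMultiplier {n : ℕ} {Ω₁ Ω₂ ω : ℝ} (hω : ω ∈ Set.Icc Ω₁ Ω₂)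
    (v w : EuclideanSpace ℂ (Fin n)) :
    star (Sum.elim v w : Fin n ⊕ Fin n → ℂ) ⬝ᵥ (niMultiplier n Ω₁ Ω₂ ω *ᵥ Sum.elim v w) =
      inner ℂ v ((I * (ω : ℂ)) • w) := by
  rw [niMultiplier, Set.indicator_of_mem hω, Matrix.smul_mulVec, Matrix.fromBlocks_mulVec]
  simp [dotProduct, PiLp.inner_apply, mul_comm, mul_left_comm, Finset.mul_sum]

theorem iqc_niMultiplier {n : ℕ} (Ω₁ Ω₂ : ℝ) (P : L2e n → L2e n) (u : L2e n) :
    iqc (niMultiplier n Ω₁ Ω₂) (Set.Icc Ω₁ Ω₂) u (P u) = niIntegral P u Ω₁ Ω₂ := by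
  rw [iqc, niIntegral]
  congr 1
  exact setIntegral_congr_fun measurableSet_Icc fun ω hω => star_dotProduct_niMultiplier hω _ _

/-- The two integrands add up to `jω` times `2 Re ⟨a, b⟩`, which is purely imaginary. This sign
change lets the same form be negative on the graph of `P` and nonnegative on the inverse graph of
`C`. -/
theorem iqc_niMultiplier_swap {n : ℕ} (Ω₁ Ω₂ : ℝ) (a b : L2e n) (ha : IsL2 (a : Signal n))
    (hb : IsL2 (b : Signal n)) :
    iqc (niMultiplier n Ω₁ Ω₂) (Set.Icc Ω₁ Ω₂) b a =
      -iqc (niMultiplier n Ω₁ Ω₂) (Set.Icc Ω₁ Ω₂) a b := by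
  have hM := isBoundedMultiplier_niMultiplier n Ω₁ Ω₂
  have h1 := (integrable_quadForm hM hb ha).integrableOn (s := Set.Icc Ω₁ Ω₂)
  have h2 := (integrable_quadForm hM ha hb).integrableOn (s := Set.Icc Ω₁ Ω₂)
  rw [eq_neg_iff_add_eq_zero, iqc, iqc, ← Complex.add_re, ← integral_add h1 h2]
  have h3 := integral_re (𝕜 := ℂ) (h1.add h2)
  simp only [RCLike.re_eq_complex_re] at h3
  erw [← h3]
  refine setIntegral_eq_zero_of_forall_eq_zero fun ω hω => ?_
  simp only [Pi.add_apply]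
  have h4 := congrArg Complex.im (inner_conj_symm (𝕜 := ℂ) (fourierSignal (a : Signal n) ω)
    (fourierSignal (b : Signal n) ω))
  rw [Complex.conj_im] at h4
  rw [star_dotProduct_niMultiplier hω, star_dotProduct_niMultiplier hω, inner_smul_right,
    inner_smul_right]
  simp [← h4]

/-! ### Truncations and energies. -/

theorem coeFn_trunc {n : ℕ} (T : ℝ) (u : Signal n) :
    trunc T u =ᵐ[timeMeasure] (Set.Icc 0 T).indicator u := AEEqFun.coeFn_mk _ _

theorem trunc_trunc {n : ℕ} (T : ℝ) (u : Signal n) : trunc T (trunc T u) = trunc T u := by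
  refine AEEqFun.ext ?_
  filter_upwards [coeFn_trunc T (trunc T u), coeFn_trunc T u] with t h1 h2
  rw [h1, h2]
  by_cases h : t ∈ Set.Icc 0 T <;> simp [h, h2]

theorem IsL2.trunc {n : ℕ} {u : Signal n} (hu : IsL2 u) (T : ℝ) : IsL2 (trunc T u) :=
  (memLp_congr_ae (coeFn_trunc T u)).2 (MemLp.indicator measurableSet_Icc hu)

theorem IsL2.mem_L2e {n : ℕ} {u : Signal n} (hu : IsL2 u) : u ∈ L2e n := fun T _ => hu.trunc T

theorem eLpNorm_trunc_le {n : ℕ} (T : ℝ) (u : Signal n) :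
    eLpNorm (trunc T u) 2 timeMeasure ≤ eLpNorm u 2 timeMeasure := by
  rw [eLpNorm_congr_ae (coeFn_trunc T u)]
  exact eLpNorm_indicator_le _

theorem energy_trunc_le {n : ℕ} {u : Signal n} (hu : IsL2 u) (T : ℝ) :
    energy (trunc T u) ≤ energy u :=
  pow_le_pow_left₀ ENNReal.toReal_nonneg (ENNReal.toReal_mono hu.2.ne (eLpNorm_trunc_le T u)) 2

/-- `Γ_0` keeps only the null set `{0}`. This settles `T = 0`, which gain bounds include but `L2e`
and causality do not. -/
theorem energy_trunc_zero {n : ℕ} (u : Signal n) : energy (trunc 0 u) = 0 := by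
  have h : ∀ᵐ t ∂timeMeasure, trunc 0 u t = 0 := by
    have h0 : ∀ᵐ t ∂timeMeasure, t ≠ (0 : ℝ) :=
      ae_restrict_of_ae (Measure.ae_ne volume 0)
    filter_upwards [coeFn_trunc 0 u, h0] with t h1 h2
    rw [h1, Set.Icc_self, Set.indicator_of_notMem (by simpa using h2)]
  rw [energy, norm2, eLpNorm_congr_ae (g := 0) h]
  simp

/-- Fatou's lemma along the truncations at `T = k + 1`, which are positive and converge pointwise.
-/
theorem eLpNorm_le_of_trunc {n : ℕ} {u : Signal n} {B : ℝ≥0∞}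
    (h : ∀ T : ℝ, 0 < T → eLpNorm (trunc T u) 2 timeMeasure ≤ B) :
    eLpNorm u 2 timeMeasure ≤ B := by
  have hlim : ∀ᵐ t ∂timeMeasure, Filter.Tendsto
      (fun k : ℕ => (Set.Icc 0 ((k : ℝ) + 1)).indicator u t) Filter.atTop (nhds (u t)) := by
    filter_upwards [ae_restrict_mem measurableSet_Ici] with t ht
    obtain ⟨N, hN⟩ := exists_nat_ge t
    refine tendsto_const_nhds.congr' ?_
    filter_upwards [Filter.eventually_ge_atTop N] with k hk
    have hk' : (N : ℝ) ≤ k := by exact_mod_cast hk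
    rw [Set.indicator_of_mem]
    exact ⟨ht, by linarith⟩
  refine (Lp.eLpNorm_lim_le_liminf_eLpNorm
    (fun k => u.aestronglyMeasurable.indicator measurableSet_Icc) _ hlim).trans ?_
  refine Filter.liminf_le_of_le (by isBoundedDefault) fun b hb => ?_
  obtain ⟨k, hk⟩ := hb.exists
  refine hk.trans ?_
  rw [← eLpNorm_congr_ae (coeFn_trunc _ u)]
  exact h _ (by positivity)

theorem isL2_of_trunc {n : ℕ} (u : L2e n) {B : ℝ}
    (h : ∀ T : ℝ, 0 < T → energy (trunc T (u : Signal n)) ≤ B) :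
    IsL2 (u : Signal n) ∧ energy (u : Signal n) ≤ B := by
  have hB : 0 ≤ B := (energy_nonneg _).trans (h 1 one_pos)
  have h1 : eLpNorm (u : Signal n) 2 timeMeasure ≤ ENNReal.ofReal (Real.sqrt B) := by
    refine eLpNorm_le_of_trunc fun T hT => ?_
    rw [← ENNReal.ofReal_toReal (u.2 T hT).2.ne]
    exact ENNReal.ofReal_le_ofReal (Real.le_sqrt_of_sq_le (h T hT))
  refine ⟨⟨(u : Signal n).aestronglyMeasurable, h1.trans_lt ENNReal.ofReal_lt_top⟩, ?_⟩
  have h2 : norm2 (u : Signal n) ≤ Real.sqrt B := by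
    have := ENNReal.toReal_mono ENNReal.ofReal_ne_top h1
    rwa [ENNReal.toReal_ofReal (Real.sqrt_nonneg _)] at this
  calc energy (u : Signal n) ≤ Real.sqrt B ^ 2 :=
        pow_le_pow_left₀ ENNReal.toReal_nonneg h2 2
    _ = B := Real.sq_sqrt hB

theorem energy_smul {n : ℕ} (c : ℝ) (u : Signal n) : energy (c • u) = c ^ 2 * energy u := by
  rw [energy, norm2, eLpNorm_congr_ae (AEEqFun.coeFn_smul c u), eLpNorm_const_smul,
    ENNReal.toReal_mul, mul_pow, energy, norm2]
  simp

theorem energy_neg {n : ℕ} (u : Signal n) : energy (-u) = energy u := by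
  rw [← neg_one_smul ℝ, energy_smul]; norm_num

theorem energy_add_le {n : ℕ} {u v : Signal n} (hu : IsL2 u) (hv : IsL2 v) :
    energy (u + v) ≤ 2 * energy u + 2 * energy v := by
  have h : norm2 (u + v) ≤ norm2 u + norm2 v := by
    rw [norm2, norm2, norm2, ← ENNReal.toReal_add hu.2.ne hv.2.ne,
      eLpNorm_congr_ae (AEEqFun.coeFn_add u v)]
    exact ENNReal.toReal_mono (ENNReal.add_ne_top.2 ⟨hu.2.ne, hv.2.ne⟩)
      (eLpNorm_add_le hu.1 hv.1 one_le_two)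
  have h0 : 0 ≤ norm2 (u + v) := ENNReal.toReal_nonneg
  simp only [energy]
  nlinarith [sq_nonneg (norm2 u - norm2 v)]

/-- Finite-gain stability in terms of energies. -/
theorem Stable.exists_energy_gain {n : ℕ} {P : L2e n → L2e n} (hP : Stable P) :
    ∃ κ : ℝ, 0 ≤ κ ∧ ∀ T : ℝ, 0 ≤ T → ∀ u : L2e n,
      energy (trunc T (P u : Signal n)) ≤ κ * energy (trunc T (u : Signal n)) := by
  obtain ⟨α, -, h⟩ := hP
  refine ⟨α ^ 2, sq_nonneg _, fun T hT u => ?_⟩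
  rw [energy, energy, ← mul_pow]
  exact pow_le_pow_left₀ ENNReal.toReal_nonneg (h T hT u) 2

theorem isL2_and_energy_le {n : ℕ} {P : L2e n → L2e n} {κ : ℝ} (hκ : 0 ≤ κ)
    (h : ∀ T : ℝ, 0 ≤ T → ∀ u : L2e n,
      energy (trunc T (P u : Signal n)) ≤ κ * energy (trunc T (u : Signal n)))
    {u : L2e n} (hu : IsL2 (u : Signal n)) :
    IsL2 (P u : Signal n) ∧ energy (P u : Signal n) ≤ κ * energy (u : Signal n) :=
  isL2_of_trunc _ fun T hT => (h T hT.le u).trans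
    (mul_le_mul_of_nonneg_left (energy_trunc_le hu T) hκ)

/-! ### The uniform estimate -/

theorem niIntegral_smul {n : ℕ} (C : L2e n → L2e n) (τ : ℝ) {y : L2e n}
    (hCy : IsL2 (C y : Signal n)) (Ω₁ Ω₂ : ℝ) :
    niIntegral (τ • C) y Ω₁ Ω₂ = τ * niIntegral C y Ω₁ Ω₂ := by
  rw [niIntegral, niIntegral, ← Complex.re_ofReal_mul, ← integral_const_mul]
  congr 1
  refine integral_congr_ae (ae_restrict_of_ae ?_)
  filter_upwards [fourierSignal_smul τ hCy] with ω hω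
  rw [Pi.smul_apply, Submodule.coe_smul, hω, smul_comm, inner_smul_right]

/-- Only subadditivity is used, so overlaps of the bands and the order of `Ω₁` and `Ω₂` are
irrelevant. -/
theorem setIntegral_Ici_le_bands {f : ℝ → ℝ} (hf : Integrable f) (h0 : ∀ ω, 0 ≤ f ω) (Ω₁ Ω₂ : ℝ) :
    ∫ ω in Set.Ici (0 : ℝ), f ω ≤ (∫ ω in Set.Icc 0 Ω₁, f ω) + (∫ ω in Set.Icc Ω₁ Ω₂, f ω) +
      ∫ ω in Set.Ici Ω₂, f ω := by
  have hsub : Set.Ici (0 : ℝ) ⊆ (Set.Icc 0 Ω₁ ∪ Set.Icc Ω₁ Ω₂) ∪ Set.Ici Ω₂ := by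
    intro ω hω
    rcases le_total ω Ω₁ with h | h
    · exact Or.inl (Or.inl ⟨hω, h⟩)
    rcases le_total ω Ω₂ with h' | h'
    · exact Or.inl (Or.inr ⟨h, h'⟩)
    · exact Or.inr h'
  have hunion : ∀ A B : Set ℝ, ∫ ω in A ∪ B, f ω ≤ (∫ ω in A, f ω) + ∫ ω in B, f ω := by
    intro A B
    rw [← integral_add_measure hf.integrableOn hf.integrableOn]
    exact integral_mono_measure (Measure.restrict_union_le A B)
      (Filter.Eventually.of_forall h0)
      (Integrable.add_measure hf.integrableOn hf.integrableOn)
  refine (setIntegral_mono_set hf.integrableOn (Filter.Eventually.of_forall h0)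
    hsub.eventuallyLE).trans ((hunion _ _).trans ?_)
  gcongr
  exact hunion _ _

/-- Absorbing a small multiple of the quantity to be bounded. -/
theorem exists_absorption {K c κ : ℝ} (hK : 0 ≤ K) (hc : 0 < c) (hκ : 0 ≤ κ) :
    ∃ η : ℝ, 0 < η ∧ ∃ g : ℝ, 0 ≤ g ∧ ∀ E E' D : ℝ, 0 ≤ E → E' ≤ κ * E →
      c * (E / 2) ≤ K * (η * (E' + E) + (1 + 1 / η) * D) → E ≤ g * D := by
  -- Makes the `E`-part of the right side at most `c / 4 * E`, half of the left side; `K + 1` avoids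
  -- division by zero.
  set η := c / (4 * (K + 1) * (1 + κ)) with hη
  have hηpos : 0 < η := by positivity
  have hKη : K * (η * (1 + κ)) ≤ c / 4 := by
    have : η * (1 + κ) = c / (4 * (K + 1)) := by rw [hη]; field_simp
    rw [this, ← mul_div_assoc, div_le_div_iff₀ (by positivity) (by positivity)]
    nlinarith
  clear_value η
  refine ⟨η, hηpos, 4 * (K * (1 + 1 / η)) / c, by positivity, fun E E' D hE hE' h => ?_⟩
  have h1 : K * (η * (E' + E) + (1 + 1 / η) * D) ≤ c / 4 * E + K * (1 + 1 / η) * D :=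
    calc _ ≤ K * (η * (κ * E + E) + (1 + 1 / η) * D) := by gcongr
      _ = K * (η * (1 + κ)) * E + K * (1 + 1 / η) * D := by ring
      _ ≤ _ := by gcongr
  rw [div_mul_eq_mul_div, le_div_iff₀ hc]
  linarith

/-- The frequency-domain conditions bound finite-energy solutions of the loop equations,
uniformly in `τ`. -/
theorem exists_uniform_energy_bound {n : ℕ} {P C : L2e n → L2e n}
    (hP_sni : IsSNI P) (hC_ni : IsNI C)
    {M₀ Minf : ℝ → Matrix (Fin n ⊕ Fin n) (Fin n ⊕ Fin n) ℂ}
    (hM₀ : IsBoundedMultiplier M₀) (hMinf : IsBoundedMultiplier Minf)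
    {Ωl Ωh ε₀ εinf : ℝ} (hΩl : 0 < Ωl) (hε₀ : 0 < ε₀) (hεinf : 0 < εinf)
    (hiqc : ∀ Ω₁ Ω₂ τ : ℝ, 0 < Ω₁ → Ω₁ ≤ Ωl → Ωh ≤ Ω₂ → τ ∈ Set.Icc (0 : ℝ) 1 →
      ∀ u y : L2e n, IsL2 (u : Signal n) → IsL2 (y : Signal n) →
        iqc M₀ (Set.Icc 0 Ω₁) (P u) u ≤
            -ε₀ * ∫ ω in Set.Icc 0 Ω₁, ‖fourierSignal (u : Signal n) ω‖ ^ 2 ∧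
        0 ≤ iqc M₀ (Set.Icc 0 Ω₁) y ((τ • C) y) ∧
        iqc Minf (Set.Ici Ω₂) (P u) u ≤
            -εinf * ∫ ω in Set.Ici Ω₂, ‖fourierSignal (u : Signal n) ω‖ ^ 2 ∧
        0 ≤ iqc Minf (Set.Ici Ω₂) y ((τ • C) y)) :
    ∃ γ : ℝ, 0 < γ ∧ ∀ τ ∈ Set.Icc (0 : ℝ) 1, ∀ u y : L2e n, IsL2 (u : Signal n) →
      IsL2 (y : Signal n) → energy (u : Signal n) + energy (y : Signal n) ≤
        γ * (energy ((u - (τ • C) y : L2e n) : Signal n) +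
          energy ((y - P u : L2e n) : Signal n)) := by
  obtain ⟨hPs, Ωp, Ωp', hΩp, -, hPni⟩ := hP_sni
  obtain ⟨hCs, Ωc, Ωc', hΩc, -, hCni⟩ := hC_ni
  obtain ⟨κ, hκ, hPκ⟩ := hPs.exists_energy_gain
  obtain ⟨κ', hκ', hCκ⟩ := hCs.exists_energy_gain
  obtain ⟨Ω₁, hΩ₁, h1l, h1p, h1c⟩ : ∃ Ω₁ : ℝ, 0 < Ω₁ ∧ Ω₁ ≤ Ωl ∧ Ω₁ ≤ Ωp ∧ Ω₁ ≤ Ωc :=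
    ⟨min Ωl (min Ωp Ωc), by positivity, by simp, by simp, by simp⟩
  obtain ⟨Ω₂, h2h, h2p, h2c⟩ : ∃ Ω₂ : ℝ, Ωh ≤ Ω₂ ∧ Ωp' ≤ Ω₂ ∧ Ωc' ≤ Ω₂ :=
    ⟨max Ωh (max Ωp' Ωc'), by simp, by simp, by simp⟩
  obtain ⟨ε, hε, hPε⟩ := hPni Ω₁ Ω₂ hΩ₁ h1p h2p
  have hCε := hCni Ω₁ Ω₂ hΩ₁ h1c h2c
  obtain ⟨K₀, hK₀, hQ₀⟩ := exists_iqc_add_le hM₀ (Set.Icc 0 Ω₁)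
  obtain ⟨K₁, hK₁, hQ₁⟩ :=
    exists_iqc_add_le (isBoundedMultiplier_niMultiplier n Ω₁ Ω₂) (Set.Icc Ω₁ Ω₂)
  obtain ⟨K₂, hK₂, hQ₂⟩ := exists_iqc_add_le hMinf (Set.Ici Ω₂)
  obtain ⟨c, hc, hc0, hc1, hc2⟩ : ∃ c : ℝ, 0 < c ∧ c ≤ ε₀ ∧ c ≤ ε ∧ c ≤ εinf :=
    ⟨min ε₀ (min ε εinf), by positivity, by simp, by simp, by simp⟩
  obtain ⟨η, hηpos, g, hg, habs⟩ :=
    exists_absorption (add_nonneg (add_nonneg hK₀ hK₁) hK₂) hc hκ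
  -- With `D` the input energy, `energy u ≤ g D` and `energy y ≤ 2 κ energy u + 2 D`.
  refine ⟨(1 + 2 * κ) * g + 2, by positivity, fun τ hτ u y hu hy => ?_⟩
  obtain ⟨hPu, hPu'⟩ := isL2_and_energy_le hκ hPκ hu
  obtain ⟨hCy, -⟩ := isL2_and_energy_le hκ' hCκ hy
  have hτCy : IsL2 (((τ • C) y : L2e n) : Signal n) := hCy.smul τ
  set p : L2e n := y - P u with hp
  -- The sign is chosen so that `(P u, u) + (p, q) = (y, τ C y)`.
  set q : L2e n := -(u - (τ • C) y) with hq
  have hpL : IsL2 (p : Signal n) := hy.sub hPu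
  have hqL : IsL2 (q : Signal n) := by
    have h := (hu.sub hτCy).smul (-1)
    rwa [neg_one_smul] at h
  have hqE : energy ((u - (τ • C) y : L2e n) : Signal n) = energy (q : Signal n) :=
    (energy_neg _).symm
  rw [hqE]
  have hyp : P u + p = y := by rw [hp]; abel
  have hyq : u + q = (τ • C) y := by rw [hq]; abel
  obtain ⟨i1, i2, i3, i4⟩ := hiqc Ω₁ Ω₂ τ hΩ₁ h1l h2h hτ u y hu hy
  have j0 := hQ₀ η hηpos (P u) u p q hPu hu hpL hqL
  have j1 := hQ₁ η hηpos (P u) u p q hPu hu hpL hqL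
  have j2 := hQ₂ η hηpos (P u) u p q hPu hu hpL hqL
  rw [hyp, hyq] at j0 j1 j2
  have k1 : iqc (niMultiplier n Ω₁ Ω₂) (Set.Icc Ω₁ Ω₂) (P u) u ≤
      -(ε * ∫ ω in Set.Icc Ω₁ Ω₂, ‖fourierSignal (u : Signal n) ω‖ ^ 2) := by
    rw [iqc_niMultiplier_swap Ω₁ Ω₂ u (P u) hu hPu, iqc_niMultiplier]
    exact neg_le_neg (hPε u hu)
  have k2 : 0 ≤ iqc (niMultiplier n Ω₁ Ω₂) (Set.Icc Ω₁ Ω₂) y ((τ • C) y) := by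
    rw [iqc_niMultiplier, niIntegral_smul C τ hCy]
    exact mul_nonneg hτ.1 (hCε y hy)
  have hband := setIntegral_Ici_le_bands (integrable_norm_sq_fourierSignal hu)
    (fun ω => sq_nonneg _) Ω₁ Ω₂
  rw [setIntegral_Ici_norm_sq_fourierSignal hu] at hband
  have l0 : 0 ≤ ∫ ω in Set.Icc 0 Ω₁, ‖fourierSignal (u : Signal n) ω‖ ^ 2 :=
    integral_nonneg fun ω => sq_nonneg _
  have l1 : 0 ≤ ∫ ω in Set.Icc Ω₁ Ω₂, ‖fourierSignal (u : Signal n) ω‖ ^ 2 :=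
    integral_nonneg fun ω => sq_nonneg _
  have l2 : 0 ≤ ∫ ω in Set.Ici Ω₂, ‖fourierSignal (u : Signal n) ω‖ ^ 2 :=
    integral_nonneg fun ω => sq_nonneg _
  have m0 := mul_le_mul_of_nonneg_right hc0 l0
  have m1 := mul_le_mul_of_nonneg_right hc1 l1
  have m2 := mul_le_mul_of_nonneg_right hc2 l2
  have hcE := mul_le_mul_of_nonneg_left hband hc.le
  -- Adding the three perturbation inequalities leaves `c` times the integral of `|û|²` over `ω ≥
  -- 0`, that is `c * (energy u / 2)`, on the left.
  have hEu := habs (energy (u : Signal n)) (energy (P u : Signal n))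
    (energy (p : Signal n) + energy (q : Signal n)) (energy_nonneg _) hPu' (by linarith)
  have hEy : energy (y : Signal n) ≤ 2 * energy (P u : Signal n) + 2 * energy (p : Signal n) := by
    have h := energy_add_le hPu hpL
    rwa [← Submodule.coe_add, hyp] at h
  have hEq := energy_nonneg (q : Signal n)
  have h5 := mul_le_mul_of_nonneg_left hEu hκ
  rw [add_comm (energy (q : Signal n))]
  linarith

/-! ### The homotopy in `τ` -/

theorem energy_trunc_add_le {n : ℕ} {T : ℝ} (hT : 0 ≤ T) (a b : L2e n) :
    energy (trunc T ((a + b : L2e n) : Signal n)) ≤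
      2 * energy (trunc T (a : Signal n)) + 2 * energy (trunc T (b : Signal n)) := by
  rcases hT.eq_or_lt with rfl | hT
  · simp [energy_trunc_zero]
  · rw [Submodule.coe_add, trunc_add]
    exact energy_add_le (a.2 T hT) (b.2 T hT)

/-- `‖Γ_T d‖₂²` for a pair of signals. -/
def pairEnergy {n : ℕ} (T : ℝ) (d : L2e n × L2e n) : ℝ :=
  energy (trunc T (d.1 : Signal n)) + energy (trunc T (d.2 : Signal n))

/-- The energy gain of `G` is at most `κ`. -/
def HasEnergyGain {n : ℕ} (G : L2e n × L2e n → L2e n × L2e n) (κ : ℝ) : Prop :=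
  ∀ T : ℝ, 0 ≤ T → ∀ d : L2e n × L2e n, pairEnergy T (G d) ≤ κ * pairEnergy T d

theorem pairStable_of_hasEnergyGain {n : ℕ} {G : L2e n × L2e n → L2e n × L2e n} {κ : ℝ}
    (hκ : 0 < κ) (h : HasEnergyGain G κ) : PairStable G := by
  refine ⟨Real.sqrt κ, Real.sqrt_pos.2 hκ, fun T hT d => ?_⟩
  rw [pairNorm2, pairNorm2, ← Real.sqrt_mul hκ.le]
  exact Real.sqrt_le_sqrt (h T hT d)

/-- The truncation of a pair of extended signals. -/
def truncPair {n : ℕ} {T : ℝ} (hT : 0 < T) (d : L2e n × L2e n) : L2e n × L2e n :=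
  (⟨trunc T (d.1 : Signal n), (d.1.2 T hT).mem_L2e⟩,
    ⟨trunc T (d.2 : Signal n), (d.2.2 T hT).mem_L2e⟩)

/-- A finite-gain inverse of the loop map has the gain that holds for finite-energy solutions. -/
theorem HasEnergyGain.improve {n : ℕ} {P C : L2e n → L2e n}
    {G : L2e n × L2e n → L2e n × L2e n} (hG : IsCausalLoopInverse P C G) {κ γ : ℝ} (hκ : 0 ≤ κ)
    (hgain : HasEnergyGain G κ)
    (hbound : ∀ u y : L2e n, IsL2 (u : Signal n) → IsL2 (y : Signal n) →
      energy (u : Signal n) + energy (y : Signal n) ≤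
        γ * (energy ((u - C y : L2e n) : Signal n) + energy ((y - P u : L2e n) : Signal n))) :
    HasEnergyGain G γ := by
  intro T hT d
  rcases hT.eq_or_lt with rfl | hT
  · simp [pairEnergy, energy_trunc_zero]
  obtain ⟨-, hright, hcausal⟩ := hG
  set e := truncPair hT d with he
  have he1 : IsL2 (e.1 : Signal n) := d.1.2 T hT
  have he2 : IsL2 (e.2 : Signal n) := d.2.2 T hT
  -- The gain `κ` serves only to show that `G e` has finite energy; its value does not enter the
  -- conclusion.
  have hS : ∀ S : ℝ, 0 < S → pairEnergy S (G e) ≤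
      κ * (energy (e.1 : Signal n) + energy (e.2 : Signal n)) := fun S hS =>
    (hgain S hS.le e).trans (mul_le_mul_of_nonneg_left
      (add_le_add (energy_trunc_le he1 S) (energy_trunc_le he2 S)) hκ)
  obtain ⟨h1, -⟩ := isL2_of_trunc (G e).1 fun S hS' =>
    (le_add_of_nonneg_right (energy_nonneg _)).trans (hS S hS')
  obtain ⟨h2, -⟩ := isL2_of_trunc (G e).2 fun S hS' =>
    (le_add_of_nonneg_left (energy_nonneg _)).trans (hS S hS')
  have hb := hbound (G e).1 (G e).2 h1 h2
  have hloop : ((G e).1 - C (G e).2, (G e).2 - P (G e).1) = e := hright e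
  have hloop1 : (G e).1 - C (G e).2 = e.1 := congrArg Prod.fst hloop
  have hloop2 : (G e).2 - P (G e).1 = e.2 := congrArg Prod.snd hloop
  rw [hloop1, hloop2] at hb
  -- By causality, truncating the input at `T` does not change the output up to `T`.
  obtain ⟨c1, c2⟩ := hcausal T hT e d (trunc_trunc T _) (trunc_trunc T _)
  calc pairEnergy T (G d) = pairEnergy T (G e) := by rw [pairEnergy, pairEnergy, c1, c2]
    _ ≤ energy ((G e).1 : Signal n) + energy ((G e).2 : Signal n) :=
      add_le_add (energy_trunc_le h1 T) (energy_trunc_le h2 T)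
    _ ≤ γ * pairEnergy T d := hb

/-- A gain bound at `τ` yields one at all nearby `σ`. -/
theorem HasEnergyGain.perturb {n : ℕ} {P C : L2e n → L2e n} {κ γ τ σ : ℝ} (hγ : 0 ≤ γ)
    (hC : ∀ T : ℝ, 0 ≤ T → ∀ u : L2e n,
      energy (trunc T (C u : Signal n)) ≤ κ * energy (trunc T (u : Signal n)))
    {G H : L2e n × L2e n → L2e n × L2e n} (hG : IsCausalLoopInverse P (τ • C) G)
    (hH : IsCausalLoopInverse P (σ • C) H) (hgain : HasEnergyGain G γ)
    (hστ : 4 * γ * κ * (σ - τ) ^ 2 ≤ 1) : HasEnergyGain H (4 * γ) := by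
  intro T hT d
  obtain ⟨hleft, -, -⟩ := hG
  obtain ⟨-, hright, -⟩ := hH
  set x := H d with hx
  have hloop : (x.1 - (σ • C) x.2, x.2 - P x.1) = d := hright d
  have hd1 : x.1 - (σ • C) x.2 = d.1 := congrArg Prod.fst hloop
  have hd2 : x.2 - P x.1 = d.2 := congrArg Prod.snd hloop
  -- The solution at `σ` also solves the loop at `τ`, with the mismatch `(σ - τ) C x₂` moved into
  -- the first input.
  have hxG : G (d.1 + (σ - τ) • C x.2, d.2) = x := by
    have h : loopMap P (τ • C) x = (d.1 + (σ - τ) • C x.2, d.2) := by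
      have hsub : (σ - τ) • C x.2 = σ • C x.2 - τ • C x.2 := sub_smul σ τ (C x.2)
      rw [loopMap, ← hd1, ← hd2, Pi.smul_apply, Pi.smul_apply, hsub]
      congr 1
      abel
    rw [← h]
    exact hleft x
  have h1 := hgain T hT (d.1 + (σ - τ) • C x.2, d.2)
  rw [hxG] at h1
  have h2 := energy_trunc_add_le hT d.1 ((σ - τ) • C x.2)
  rw [Submodule.coe_smul, trunc_smul, energy_smul] at h2
  have h3 := mul_le_mul_of_nonneg_left (hC T hT x.2) (sq_nonneg (σ - τ))
  have h4 := energy_nonneg (trunc T (x.2 : Signal n))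
  -- Half of this inequality bounds the mismatch term `2 γ κ (σ - τ)² energy x₂` by `energy x₂ / 2`,
  -- which the left side absorbs.
  have h5 := mul_le_mul_of_nonneg_right hστ h4
  have h6 := energy_nonneg (trunc T (x.1 : Signal n))
  have h7 := mul_nonneg hγ (energy_nonneg (trunc T (d.2 : Signal n)))
  have h8 : γ * energy (trunc T ((d.1 + (σ - τ) • C x.2 : L2e n) : Signal n)) ≤
      γ * (2 * energy (trunc T (d.1 : Signal n)) +
        2 * ((σ - τ) ^ 2 * (κ * energy (trunc T (x.2 : Signal n))))) :=
    mul_le_mul_of_nonneg_left (by linarith) hγ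
  simp only [pairEnergy] at h1 ⊢
  linarith

/-- Without feedback the loop inherits the gain of `P`. -/
theorem hasEnergyGain_zero_smul {n : ℕ} {P C : L2e n → L2e n} {κ : ℝ} (hκ : 0 ≤ κ)
    (hP : ∀ T : ℝ, 0 ≤ T → ∀ u : L2e n,
      energy (trunc T (P u : Signal n)) ≤ κ * energy (trunc T (u : Signal n)))
    {G : L2e n × L2e n → L2e n × L2e n} (hG : IsCausalLoopInverse P ((0 : ℝ) • C) G) :
    HasEnergyGain G (2 * κ + 2) := by
  intro T hT d
  set x := G d with hx
  have hloop : (x.1 - ((0 : ℝ) • C) x.2, x.2 - P x.1) = d := hG.2.1 d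
  have hd1 : x.1 = d.1 := by
    have h := congrArg Prod.fst hloop
    simpa using h
  have hd2 : x.2 = d.2 + P d.1 := by
    rw [← hd1, ← congrArg Prod.snd hloop]
    exact (sub_add_cancel _ _).symm
  have h1 := energy_trunc_add_le hT d.2 (P d.1)
  have h2 := hP T hT d.1
  have h3 := energy_nonneg (trunc T (d.1 : Signal n))
  have h4 := mul_nonneg hκ (energy_nonneg (trunc T (d.2 : Signal n)))
  rw [pairEnergy, pairEnergy, hd1, hd2]
  linarith

/-- If finite-energy solutions of the loops `P # (τ C)` are bounded uniformly in `τ`, then stability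
propagates from `τ = 0` to `τ = 1`. -/
theorem loopStable_of_uniform_energy_bound {n : ℕ} {P C : L2e n → L2e n} (hP : Stable P)
    (hC : Stable C) (hwp : ∀ τ : ℝ, τ ∈ Set.Icc (0 : ℝ) 1 → WellPosed P (τ • C)) {γ : ℝ}
    (hγ : 0 < γ)
    (hbound : ∀ τ ∈ Set.Icc (0 : ℝ) 1, ∀ u y : L2e n, IsL2 (u : Signal n) →
      IsL2 (y : Signal n) → energy (u : Signal n) + energy (y : Signal n) ≤
        γ * (energy ((u - (τ • C) y : L2e n) : Signal n) +
          energy ((y - P u : L2e n) : Signal n))) :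
    LoopStable P C := by
  obtain ⟨κP, hκP, hPκ⟩ := hP.exists_energy_gain
  obtain ⟨κ, hκ, hCκ⟩ := hC.exists_energy_gain
  choose! G hG using hwp
  -- With step `1 / (m + 1)`, the smallness condition of `HasEnergyGain.perturb` becomes `4 γ κ ≤ (m
  -- + 1)²`.
  obtain ⟨m, hm⟩ := exists_nat_ge (4 * γ * κ)
  have hstep : ∀ k : ℕ, k ≤ m + 1 →
      ((k : ℝ) / (m + 1 : ℕ)) ∈ Set.Icc (0 : ℝ) 1 ∧
        HasEnergyGain (G ((k : ℝ) / (m + 1 : ℕ))) γ := by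
    have hmem : ∀ k : ℕ, k ≤ m + 1 → ((k : ℝ) / (m + 1 : ℕ)) ∈ Set.Icc (0 : ℝ) 1 := by
      intro k hk
      refine ⟨by positivity, ?_⟩
      rw [div_le_one (by positivity)]
      exact_mod_cast hk
    intro k
    induction k with
    | zero =>
      intro hk
      refine ⟨hmem 0 hk, ?_⟩
      have h0 : ((0 : ℕ) : ℝ) / (m + 1 : ℕ) = 0 := by simp
      have h01 : (0 : ℝ) ∈ Set.Icc (0 : ℝ) 1 := by simp
      rw [h0]
      exact HasEnergyGain.improve (hG 0 h01) (by positivity)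
        (hasEnergyGain_zero_smul hκP hPκ (hG 0 h01)) (hbound 0 h01)
    | succ k ih =>
      intro hk
      obtain ⟨hk0, hgain⟩ := ih (by omega)
      have hk1 := hmem (k + 1) hk
      refine ⟨hk1, ?_⟩
      -- The gain `4γ` after a step drops back to `γ`, so gains do not accumulate and the step
      -- length can stay fixed.
      refine HasEnergyGain.improve (hG _ hk1) (κ := 4 * γ) (by positivity) ?_ (hbound _ hk1)
      refine HasEnergyGain.perturb hγ.le hCκ (hG _ hk0) (hG _ hk1) hgain ?_
      have hd : ((k + 1 : ℕ) : ℝ) / (m + 1 : ℕ) - (k : ℝ) / (m + 1 : ℕ) = 1 / ((m : ℝ) + 1) := by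
        push_cast
        ring
      rw [hd, one_div, inv_pow, ← div_eq_mul_inv, div_le_one (by positivity)]
      nlinarith [(Nat.cast_nonneg m : (0 : ℝ) ≤ m)]
  obtain ⟨h1, hgain⟩ := hstep (m + 1) le_rfl
  rw [div_self (by positivity)] at h1 hgain
  have hG1 := hG 1 h1
  rw [one_smul] at hG1
  exact ⟨G 1, hG1, pairStable_of_hasEnergyGain hγ hgain⟩

end NegImag

end

open NegImag in
theorem proposition3 (n : ℕ) (P C : L2e n → L2e n)
    (hP : IsSystem P) (hC : IsSystem C) (hP_sni : IsSNI P) (hC_ni : IsNI C)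
    (hwp : ∀ τ : ℝ, τ ∈ Set.Icc (0 : ℝ) 1 → WellPosed P (τ • C))
    (M₀ Minf : ℝ → Matrix (Fin n ⊕ Fin n) (Fin n ⊕ Fin n) ℂ)
    (hM₀ : IsHermitianMultiplier M₀) (hMinf : IsHermitianMultiplier Minf)
    (Ωl Ωh ε₀ εinf : ℝ) (hΩl : 0 < Ωl) (hΩ : Ωl < Ωh) (hε₀ : 0 < ε₀) (hεinf : 0 < εinf)
    (hiqc : ∀ Ω₁ Ω₂ τ : ℝ, 0 < Ω₁ → Ω₁ ≤ Ωl → Ωh ≤ Ω₂ → τ ∈ Set.Icc (0 : ℝ) 1 →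
      ∀ u y : L2e n, IsL2 (u : Signal n) → IsL2 (y : Signal n) →
        iqc M₀ (Set.Icc 0 Ω₁) (P u) u ≤
            -ε₀ * ∫ ω in Set.Icc 0 Ω₁, ‖fourierSignal (u : Signal n) ω‖ ^ 2 ∧
        0 ≤ iqc M₀ (Set.Icc 0 Ω₁) y ((τ • C) y) ∧
        iqc Minf (Set.Ici Ω₂) (P u) u ≤
            -εinf * ∫ ω in Set.Ici Ω₂, ‖fourierSignal (u : Signal n) ω‖ ^ 2 ∧
        0 ≤ iqc Minf (Set.Ici Ω₂) y ((τ • C) y)) :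
    LoopStable P C := by
  obtain ⟨γ, hγ, hbound⟩ :=
    exists_uniform_energy_bound hP_sni hC_ni hM₀.1 hMinf.1 hΩl hε₀ hεinf hiqc
  exact loopStable_of_uniform_energy_bound hP_sni.1 hC_ni.1 hwp hγ hbound
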